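/- Let $n\in\mathbb N$ and equip $\mathbb{R}^{n+2}$, with Cartesian coordinates $y^0,\dots,y^{n+1}$, with the constant metric $\eta=\mathrm{diag}(+,-,\dots,-,+)$ ($n$ minus signs). Let $f$ be a smooth real function on an open set $\Omega\subseteq\mathbb{R}^{n+2}$ that is stable under multiplication by positive reals, and suppose that $f$ is homogeneous of degree $1$: $f(ty)=t\,f(y)$ for $y\in\Omega$, $t>0$. Put $$X_f=\{y\in\Omega \mid \tfrac12\eta(y,y)=0,\ f(y)=1\},$$ let $m_f:X_f\to\mathbb{R}^{n+2}$ be the inclusion and $\eta_f=m_f{}^*\eta$. Write $F=\sharp_\eta df$ (that is, $F^\alpha=\eta^{\alpha\beta}\partial_\beta f$), $\mathbf F^2=\eta(F,F)$, $(\nabla^\eta df)(u,v)=u^\alpha v^\beta\partial_\alpha\partial_\beta f$ and $\square_\eta f=\eta^{\alpha\beta}\partial_\alpha\partial_\beta f$. For symmetric bilinear forms $h,k$ let $$(h\owedge k)(x,w,u,v)=h(x,u)k(w,v)+h(w,v)k(x,u)-h(w,u)k(x,v)-h(x,v)k(w,u)$$ be their Kulkarni–Nomizu product. Then $X_f$ is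 a (possibly empty) smooth $n$-dimensional embedded submanifold of $\mathbb{R}^{n+2}$, the induced metric $\eta_f$ is nondegenerate, and the curvature of the Levi-Civita connection $\nabla$ of $(X_f,\eta_f)$, with the conventions $R(u,v)w=\nabla_u\nabla_v w-\nabla_v\nabla_u w-\nabla_{[u,v]}w$, $\ \mathrm{Rm}(x,w,u,v)=\eta_f(x,R(u,v)w)$, $\ \mathrm{Ric}_{ab}=\eta_f^{cd}R_{acbd}$, $\ \mathscr R=\eta_f^{ab}\mathrm{Ric}_{ab}$, is given by $$\mathrm{Rm}_f=m_f{}^*\bigl(-\tfrac12\,\eta\owedge[\mathbf F^2\eta-2\nabla^\eta df]\bigr),$$ $$\mathrm{Ric}_f=m_f{}^*\bigl(-(n-1)\mathbf F^2\eta+(n-2)\nabla^\eta df+(\square_\eta f)\,\eta\bigr),$$ $$\mathscr R_f=m_f{}^*\bigl[-n(n-1)\mathbf F^2+2(n-1)\,\square_\eta f\bigr].$$ -/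

import Mathlib

open scoped ContDiff

namespace NullCone

noncomputable section

/-! ### Pseudo-Riemannian geometry in a coordinate patch

A metric on an open subset of `ℝⁿ` is given by its matrix of coefficients
`g x i j = g_x(∂_i, ∂_j)`. -/

section Coordinates

variable {n : ℕ}

/-- The partial derivative `∂_i h` at `x`. -/
def pderiv (i : Fin n) (h : (Fin n → ℝ) → ℝ) (x : Fin n → ℝ) : ℝ :=
  fderiv ℝ h x (Pi.single i 1)

/-- The Christoffel symbol `Γ^k_{ij}` of the Levi-Civita connection of `g`,
`Γ^k_{ij} = ½ g^{kl} (∂_i g_{jl} + ∂_j g_{il} - ∂_l g_{ij})`. -/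
def christoffel (g : (Fin n → ℝ) → Matrix (Fin n) (Fin n) ℝ) (k i j : Fin n)
    (x : Fin n → ℝ) : ℝ :=
  (1 / 2 : ℝ) * ∑ l, (g x)⁻¹ k l *
    (pderiv i (fun z => g z j l) x + pderiv j (fun z => g z i l) x
      - pderiv l (fun z => g z i j) x)

/-- The component along `∂_l` of the curvature operator
`R(∂_a, ∂_b) ∂_d = ∇_a ∇_b ∂_d - ∇_b ∇_a ∂_d`. -/
def curvatureOp (g : (Fin n → ℝ) → Matrix (Fin n) (Fin n) ℝ) (l d a b : Fin n)
    (x : Fin n → ℝ) : ℝ :=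
  pderiv a (christoffel g l b d) x - pderiv b (christoffel g l a d) x
    + ∑ m, (christoffel g l a m x * christoffel g m b d x
        - christoffel g l b m x * christoffel g m a d x)

/-- The components `R_{cdab} = g(∂_c, R(∂_a, ∂_b) ∂_d)` of the Riemann tensor. -/
def riemannCoeff (g : (Fin n → ℝ) → Matrix (Fin n) (Fin n) ℝ) (c d a b : Fin n)
    (x : Fin n → ℝ) : ℝ :=
  ∑ l, g x c l * curvatureOp g l d a b x

/-- The components `Ric_{ab} = g^{cd} R_{acbd}` of the Ricci tensor. -/
def ricciCoeff (g : (Fin n → ℝ) → Matrix (Fin n) (Fin n) ℝ) (a b : Fin n)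
    (x : Fin n → ℝ) : ℝ :=
  ∑ c, ∑ d, (g x)⁻¹ c d * riemannCoeff g a c b d x

/-- The Riemann tensor `Rm(p, w, u, v) = g(p, R(u, v) w)` at the point `x`. -/
def riemann (g : (Fin n → ℝ) → Matrix (Fin n) (Fin n) ℝ) (x p w u v : Fin n → ℝ) : ℝ :=
  ∑ c, ∑ d, ∑ a, ∑ b, riemannCoeff g c d a b x * p c * w d * u a * v b

/-- The Ricci tensor `Ric(u, v)` at the point `x`. -/
def ricci (g : (Fin n → ℝ) → Matrix (Fin n) (Fin n) ℝ) (x u v : Fin n → ℝ) : ℝ :=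
  ∑ a, ∑ b, ricciCoeff g a b x * u a * v b

/-- The scalar curvature `g^{ab} Ric_{ab}` at the point `x`. -/
def scalarCurvature (g : (Fin n → ℝ) → Matrix (Fin n) (Fin n) ℝ) (x : Fin n → ℝ) : ℝ :=
  ∑ a, ∑ b, (g x)⁻¹ a b * ricciCoeff g a b x

end Coordinates

/-- The Kulkarni–Nomizu product of two bilinear forms. -/
def kulkarniNomizu {V : Type*} (h k : V → V → ℝ) (p w u v : V) : ℝ :=
  h p u * k w v + h w v * k p u - h w u * k p v - h p v * k w u

/-! ### The ambient space `ℝ^{n+2}` -/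

section Ambient

variable {n : ℕ}

/-- The diagonal entries of `diag(+, -, …, -, +)`; this matrix is its own inverse. -/
def sgn (α : Fin (n + 2)) : ℝ := if α = 0 ∨ α = Fin.last (n + 1) then 1 else -1

/-- The ambient metric `η`. -/
def eta (u v : Fin (n + 2) → ℝ) : ℝ := ∑ α, sgn α * u α * v α

/-- The gradient `F = ♯_η df`, with components `F^α = η^{αβ} ∂_β f`. -/
def grad (f : (Fin (n + 2) → ℝ) → ℝ) (y : Fin (n + 2) → ℝ) : Fin (n + 2) → ℝ :=
  fun α => sgn α * fderiv ℝ f y (Pi.single α 1)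

/-- The squared norm `𝐅² = η(F, F)`. -/
def gradSq (f : (Fin (n + 2) → ℝ) → ℝ) (y : Fin (n + 2) → ℝ) : ℝ :=
  eta (grad f y) (grad f y)

/-- The Hessian `∇^η df`; `η` has constant coefficients, so that `∇^η` is the ordinary
derivative and `(∇^η df)(u, v) = u^α v^β ∂_α ∂_β f`. -/
def hess (f : (Fin (n + 2) → ℝ) → ℝ) (y u v : Fin (n + 2) → ℝ) : ℝ :=
  fderiv ℝ (fderiv ℝ f) y u v

/-- The Laplacian `□_η f = η^{αβ} ∂_α ∂_β f`. -/
def box (f : (Fin (n + 2) → ℝ) → ℝ) (y : Fin (n + 2) → ℝ) : ℝ :=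
  ∑ α, sgn α * hess f y (Pi.single α 1) (Pi.single α 1)

/-- A smooth function `f`, homogeneous of degree `1` on the open cone `Ω`. -/
structure IsHomogeneousDefining (Ω : Set (Fin (n + 2) → ℝ)) (f : (Fin (n + 2) → ℝ) → ℝ) :
    Prop where
  isOpen : IsOpen Ω
  cone : ∀ y ∈ Ω, ∀ t : ℝ, 0 < t → t • y ∈ Ω
  smooth : ContDiffOn ℝ ∞ f Ω
  homogeneous : ∀ y ∈ Ω, ∀ t : ℝ, 0 < t → f (t • y) = t * f y

/-- `X_f`: the intersection of the null cone with the level set `f = 1`. -/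
def Xf (Ω : Set (Fin (n + 2) → ℝ)) (f : (Fin (n + 2) → ℝ) → ℝ) : Set (Fin (n + 2) → ℝ) :=
  {y | y ∈ Ω ∧ (1 / 2 : ℝ) * eta y y = 0 ∧ f y = 1}

/-- `φ` restricted to `U` is a smooth local parametrization (the inverse of a chart) of the
`n`-dimensional submanifold `X` of `ℝ^{n+2}`: a smooth immersion of the open set `U ⊆ ℝⁿ` which
is a homeomorphism onto a relatively open subset of `X`. -/
structure IsLocalParam (X : Set (Fin (n + 2) → ℝ)) (U : Set (Fin n → ℝ))
    (φ : (Fin n → ℝ) → (Fin (n + 2) → ℝ)) : Prop where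
  isOpen : IsOpen U
  smooth : ContDiffOn ℝ ∞ φ U
  immersion : ∀ x ∈ U, Function.Injective (fderiv ℝ φ x)
  injOn : Set.InjOn φ U
  open_image : ∀ W ⊆ U, IsOpen W → ∃ V, IsOpen V ∧ φ '' W = X ∩ V

/-- The induced metric in the coordinates given by `φ`:
`(φ^* η)_{ij} = η(∂_i φ, ∂_j φ)`. -/
def inducedMetric (φ : (Fin n → ℝ) → (Fin (n + 2) → ℝ)) (x : Fin n → ℝ) :
    Matrix (Fin n) (Fin n) ℝ :=
  Matrix.of fun i j => eta (fderiv ℝ φ x (Pi.single i 1)) (fderiv ℝ φ x (Pi.single j 1))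

end Ambient

end

end NullCone

open NullCone

open scoped Topology

/-! At a point `y` of `X_f`, Euler's identity gives η(F, y) = df(y) = f(y) = 1, while η(y, y) = 0.
So `y` and `F` span a nondegenerate plane, whatever the value of η(F, F). The differential of
(½η(y,y), f) is onto, `X_f` has codimension 2, and its tangent space is the orthogonal complement of
that plane, so the induced metric is nondegenerate.

Differentiating η(∂_jφ, φ) = 0 and df(∂_jφ) = 0 once more shows that ∂_i∂_jφ pairs with the normals
`y` and `F` to give minus the metric and minus the Hessian (`eta_coordField₂_self`,
`eta_coordField₂_grad`). As η is flat, the Gauss equation `riemannCoeff_inducedMetric` expresses the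
curvature through these pairings. On the normal plane the inverse metric is -𝐅² y⊗y + y⊗F + F⊗y,
which yields the Kulkarni–Nomizu formula (`riemannCoeff_eq`).

The Ricci and scalar formulas are traces of it. Since `y` lies in the kernel of the Hessian, every
normal term of its ambient trace vanishes, and the tangential trace is already □f (`trace_eq`,
`sum_mul_hess`). -/

namespace NullCone

/-! ### Linear algebra of the ambient metric -/

section LinearAlgebra

variable {n : ℕ}

/-- The ambient metric as a continuous bilinear map. -/
noncomputable def etaL (n : ℕ) : (Fin (n + 2) → ℝ) →L[ℝ] (Fin (n + 2) → ℝ) →L[ℝ] ℝ :=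
  (LinearMap.mk₂ ℝ eta
    (fun u v w => by simp [eta, mul_add, add_mul, Finset.sum_add_distrib])
    (fun c u v => by
      simp only [eta, Pi.smul_apply, smul_eq_mul, Finset.mul_sum]
      exact Finset.sum_congr rfl fun _ _ => by ring)
    (fun u v w => by simp [eta, mul_add, Finset.sum_add_distrib])
    (fun c u v => by
      simp only [eta, Pi.smul_apply, smul_eq_mul, Finset.mul_sum]
      exact Finset.sum_congr rfl fun _ _ => by ring)).toContinuousBilinearMap

theorem etaL_apply (u v : Fin (n + 2) → ℝ) : etaL n u v = eta u v := rfl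

theorem eta_comm (u v : Fin (n + 2) → ℝ) : eta u v = eta v u :=
  Finset.sum_congr rfl fun _ _ => by ring

theorem eta_add_left (u v w : Fin (n + 2) → ℝ) : eta (u + v) w = eta u w + eta v w := by
  simp [← etaL_apply]

theorem eta_add_right (u v w : Fin (n + 2) → ℝ) : eta u (v + w) = eta u v + eta u w := by
  simp [← etaL_apply]

theorem eta_sub_left (u v w : Fin (n + 2) → ℝ) : eta (u - v) w = eta u w - eta v w := by
  simp [← etaL_apply]

theorem eta_smul_left (c : ℝ) (u v : Fin (n + 2) → ℝ) : eta (c • u) v = c * eta u v := by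
  simp [← etaL_apply]

theorem eta_smul_right (c : ℝ) (u v : Fin (n + 2) → ℝ) : eta u (c • v) = c * eta u v := by
  simp [← etaL_apply]

theorem eta_zero_left (v : Fin (n + 2) → ℝ) : eta 0 v = 0 := by
  simp [← etaL_apply]

theorem eta_sum_left {ι : Type*} (s : Finset ι) (u : ι → Fin (n + 2) → ℝ)
    (v : Fin (n + 2) → ℝ) : eta (∑ i ∈ s, u i) v = ∑ i ∈ s, eta (u i) v := by
  simp [← etaL_apply]

theorem sgn_mul_self (α : Fin (n + 2)) : sgn α * sgn α = 1 := by
  unfold sgn; split_ifs <;> norm_num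

theorem eta_single (u : Fin (n + 2) → ℝ) (α : Fin (n + 2)) :
    eta u (Pi.single α 1) = sgn α * u α := by
  simp [eta, Pi.single_apply]

theorem eq_zero_of_eta {u : Fin (n + 2) → ℝ} (h : ∀ v, eta u v = 0) : u = 0 := by
  funext α
  have h1 := h (Pi.single α 1)
  rw [eta_single] at h1
  have h2 := sgn_mul_self α
  calc u α = (sgn α * sgn α) * u α := by rw [h2, one_mul]
    _ = 0 := by rw [mul_assoc, h1, mul_zero]

theorem eta_grad (f : (Fin (n + 2) → ℝ) → ℝ) (y v : Fin (n + 2) → ℝ) :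
    eta (grad f y) v = fderiv ℝ f y v := by
  conv_rhs => rw [pi_eq_sum_univ' v]
  simp only [eta, grad, map_sum, map_smul, smul_eq_mul]
  refine Finset.sum_congr rfl fun α _ => ?_
  rw [← mul_assoc (sgn α), sgn_mul_self, one_mul, mul_comm]

/-- Linearly independent vectors `e i`, orthogonal to a hyperbolic plane spanned by a null vector
`y` and a vector `F` with `η(F, y) = 1`. -/
structure IsAdaptedFrame (e : Fin n → Fin (n + 2) → ℝ) (y F : Fin (n + 2) → ℝ) : Prop where
  linearIndependent : LinearIndependent ℝ e
  null : eta y y = 0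
  pairing : eta F y = 1
  orthogonal_null (i : Fin n) : eta (e i) y = 0
  orthogonal_grad (i : Fin n) : eta (e i) F = 0

/-- The Gram matrix of a family of vectors. -/
def gram (e : Fin n → Fin (n + 2) → ℝ) : Matrix (Fin n) (Fin n) ℝ :=
  Matrix.of fun i j => eta (e i) (e j)

theorem gram_apply (e : Fin n → Fin (n + 2) → ℝ) (i j : Fin n) :
    gram e i j = eta (e i) (e j) := rfl

theorem gram_symm (e : Fin n → Fin (n + 2) → ℝ) : (gram e).transpose = gram e := by
  ext i j
  exact eta_comm _ _

theorem gram_inv_symm (e : Fin n → Fin (n + 2) → ℝ) (i j : Fin n) :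
    (gram e)⁻¹ i j = (gram e)⁻¹ j i := by
  conv_lhs => rw [← gram_symm e, ← Matrix.transpose_nonsing_inv]
  rfl

namespace IsAdaptedFrame

variable {e : Fin n → Fin (n + 2) → ℝ} {y F : Fin (n + 2) → ℝ}

/-- The vectors `e i`, `y`, `F` are n + 2 in number and independent, hence a basis, and `eta` is
nondegenerate. -/
theorem eq_zero_of_orthogonal (h : IsAdaptedFrame e y F) {X : Fin (n + 2) → ℝ}
    (he : ∀ i, eta X (e i) = 0) (hy : eta X y = 0) (hF : eta X F = 0) : X = 0 := by
  have hli : LinearIndependent ℝ (Sum.elim e ![y, F]) := by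
    rw [Fintype.linearIndependent_iff]
    intro g hg
    simp only [Fintype.sum_sum_type, Sum.elim_inl, Sum.elim_inr, Fin.sum_univ_two,
      Matrix.cons_val_zero, Matrix.cons_val_one] at hg
    -- Since `y` is null and orthogonal to the `e i`, pairing with `y` isolates the coefficient of
    -- `F`; pairing with `F` then isolates that of `y`.
    have h1 := congrArg (fun v => eta v y) hg
    have h2 := congrArg (fun v => eta v F) hg
    simp only [eta_add_left, eta_sum_left, eta_smul_left, h.orthogonal_null, h.orthogonal_grad,
      h.null, h.pairing, eta_zero_left, mul_zero, mul_one, Finset.sum_const_zero, zero_add]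
      at h1 h2
    rw [h1, eta_comm y F, h.pairing] at h2
    have h3 : g (Sum.inr 0) = 0 := by linarith
    rw [h1, h3, zero_smul, zero_smul, add_zero, add_zero] at hg
    have h4 := Fintype.linearIndependent_iff.mp h.linearIndependent _ hg
    rintro (i | i)
    · exact h4 i
    · fin_cases i
      · exact h3
      · exact h1
  have hspan := hli.span_eq_top_of_card_eq_finrank' (by simp)
  apply eq_zero_of_eta
  intro v
  have hle : Submodule.span ℝ (Set.range (Sum.elim e ![y, F])) ≤ (etaL n X).ker := by
    rw [Submodule.span_le]
    rintro _ ⟨i | i, rfl⟩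
    · exact he i
    · fin_cases i
      · exact hy
      · exact hF
  rw [hspan] at hle
  exact hle (Submodule.mem_top (x := v))

/-- A kernel vector of the Gram matrix gives a combination of the `e i` orthogonal to the whole
basis, hence zero, against independence. -/
theorem det_gram_ne_zero (h : IsAdaptedFrame e y F) : (gram e).det ≠ 0 := by
  intro h0
  obtain ⟨c, hc, hc0⟩ := Matrix.exists_mulVec_eq_zero_iff.mpr h0
  have hX : ∑ i, c i • e i = 0 := by
    refine h.eq_zero_of_orthogonal (fun i => ?_) ?_ ?_
    · have := congrFun hc0 i
      simp only [Matrix.mulVec, dotProduct, Pi.zero_apply, gram_apply] at this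
      rw [eta_sum_left, ← this]
      refine Finset.sum_congr rfl fun j _ => ?_
      rw [eta_smul_left, eta_comm, mul_comm]
    · simp [eta_sum_left, eta_smul_left, h.orthogonal_null]
    · simp [eta_sum_left, eta_smul_left, h.orthogonal_grad]
  exact hc (funext (Fintype.linearIndependent_iff.mp h.linearIndependent c hX))

theorem sum_inv_mul_gram (h : IsAdaptedFrame e y F) (i j : Fin n) :
    ∑ k, (gram e)⁻¹ i k * gram e k j = if i = j then 1 else 0 := by
  rw [← Matrix.mul_apply, Matrix.nonsing_inv_mul _ h.det_gram_ne_zero.isUnit, Matrix.one_apply]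

theorem sum_gram_mul_inv (h : IsAdaptedFrame e y F) (i j : Fin n) :
    ∑ k, gram e i k * (gram e)⁻¹ k j = if i = j then 1 else 0 := by
  rw [← Matrix.mul_apply, Matrix.mul_nonsing_inv _ h.det_gram_ne_zero.isUnit, Matrix.one_apply]

/-- The decomposition of a vector into its tangential and normal parts. -/
theorem decomposition (h : IsAdaptedFrame e y F) (X : Fin (n + 2) → ℝ) :
    X = (∑ l, (∑ m, (gram e)⁻¹ l m * eta X (e m)) • e l)
      + ((eta X F - eta F F * eta X y) • y + eta X y • F) := by
  -- The difference of the two sides pairs to zero with the basis. The normal coefficients come from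
  -- inverting the Gram matrix of (y, F), with rows (0, 1) and (1, η(F, F)).
  rw [← sub_eq_zero]
  refine h.eq_zero_of_orthogonal (fun i => ?_) ?_ ?_
  · rw [eta_sub_left, eta_add_left, eta_add_left, eta_smul_left, eta_smul_left,
      eta_comm y (e i), eta_comm F (e i), h.orthogonal_null, h.orthogonal_grad, eta_sum_left]
    have : ∀ l, eta ((∑ m, (gram e)⁻¹ l m * eta X (e m)) • e l) (e i)
        = ∑ m, eta X (e m) * ((gram e)⁻¹ m l * gram e l i) := by
      intro l
      rw [eta_smul_left, Finset.sum_mul]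
      refine Finset.sum_congr rfl fun m _ => ?_
      rw [gram_inv_symm e l m, gram_apply]; ring
    rw [Finset.sum_congr rfl fun l _ => this l, Finset.sum_comm]
    simp only [← Finset.mul_sum, h.sum_inv_mul_gram]
    simp
  · rw [eta_sub_left, eta_add_left, eta_add_left, eta_smul_left, eta_smul_left, h.null,
      h.pairing, eta_sum_left]
    simp [eta_smul_left, h.orthogonal_null]
  · rw [eta_sub_left, eta_add_left, eta_add_left, eta_smul_left, eta_smul_left, eta_comm y F,
      h.pairing, eta_sum_left]
    simp only [eta_smul_left, h.orthogonal_grad]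
    simp only [mul_zero, Finset.sum_const_zero]
    ring

/-- For second derivatives of φ, the tangential sum is exactly what the Christoffel terms of the
Gauss equation subtract; only the normal part survives. -/
theorem eta_eq (h : IsAdaptedFrame e y F) (X Y : Fin (n + 2) → ℝ) :
    eta X Y = (∑ l, (∑ m, (gram e)⁻¹ l m * eta X (e m)) * eta (e l) Y)
      + ((eta X F - eta F F * eta X y) * eta Y y + eta X y * eta Y F) := by
  conv_lhs => rw [h.decomposition X]
  simp only [eta_add_left, eta_sum_left, eta_smul_left]
  rw [eta_comm y Y, eta_comm F Y]

/-- The trace of a bilinear form that annihilates `y` is its trace on the span of the `e i`. -/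
theorem trace_eq (h : IsAdaptedFrame e y F)
    (H : (Fin (n + 2) → ℝ) →L[ℝ] (Fin (n + 2) → ℝ) →L[ℝ] ℝ) (h1 : H y = 0)
    (h2 : ∀ v, H v y = 0) :
    ∑ α, sgn α * H (Pi.single α 1) (Pi.single α 1)
      = ∑ l, ∑ m, (gram e)⁻¹ l m * H (e l) (e m) := by
  have hc : ∀ (u v : Fin (n + 2) → ℝ),
      ∑ α, sgn α * (eta (Pi.single α 1) v * H u (Pi.single α 1)) = H u v := by
    intro u v
    conv_rhs => rw [pi_eq_sum_univ' v]
    simp only [map_sum, map_smul, smul_eq_mul]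
    refine Finset.sum_congr rfl fun α _ => ?_
    rw [eta_comm, eta_single, ← mul_assoc, ← mul_assoc, sgn_mul_self, one_mul]
  -- Only the first slot is decomposed. The `y` term dies by `h1`; the `F` term sums over α to `H F
  -- y`, which dies by `h2`.
  have hα : ∀ α : Fin (n + 2), sgn α * H (Pi.single α 1) (Pi.single α 1)
      = (∑ l, ∑ m, (gram e)⁻¹ l m *
          (sgn α * (eta (Pi.single α 1) (e m) * H (e l) (Pi.single α 1))))
        + sgn α * (eta (Pi.single α 1) y * H F (Pi.single α 1)) := by
    intro α
    set X : Fin (n + 2) → ℝ := Pi.single α 1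
    have : H X X = (∑ l, (∑ m, (gram e)⁻¹ l m * eta X (e m)) * H (e l) X)
        + eta X y * H F X := by
      conv_lhs => rw [congrArg H (h.decomposition X)]
      simp [h1]
    rw [this, mul_add, Finset.mul_sum]
    congr 1
    refine Finset.sum_congr rfl fun l _ => ?_
    rw [Finset.sum_mul, Finset.mul_sum]
    exact Finset.sum_congr rfl fun m _ => by ring
  rw [Finset.sum_congr rfl fun α _ => hα α, Finset.sum_add_distrib, hc, h2, add_zero,
    Finset.sum_comm]
  refine Finset.sum_congr rfl fun l _ => ?_
  rw [Finset.sum_comm]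
  refine Finset.sum_congr rfl fun m _ => ?_
  rw [← Finset.mul_sum, hc]

end IsAdaptedFrame

end LinearAlgebra

/-! ### Curvature of an induced metric: the Gauss equation -/

section Gauss

variable {n : ℕ}

/-- The coordinate vector field `∂_i φ`. -/
noncomputable def coordField (φ : (Fin n → ℝ) → (Fin (n + 2) → ℝ)) (i : Fin n) (x : Fin n → ℝ) :
    Fin (n + 2) → ℝ :=
  fderiv ℝ φ x (Pi.single i 1)

/-- The second partial derivative `∂_i ∂_j φ`. -/
noncomputable def coordField₂ (φ : (Fin n → ℝ) → (Fin (n + 2) → ℝ)) (i j : Fin n)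
    (x : Fin n → ℝ) : Fin (n + 2) → ℝ :=
  fderiv ℝ (coordField φ j) x (Pi.single i 1)

theorem inducedMetric_eq_gram (φ : (Fin n → ℝ) → (Fin (n + 2) → ℝ)) (x : Fin n → ℝ) :
    inducedMetric φ x = gram fun i => coordField φ i x := rfl

theorem differentiableAt_eta {A B : (Fin n → ℝ) → (Fin (n + 2) → ℝ)} {x : Fin n → ℝ}
    (hA : DifferentiableAt ℝ A x) (hB : DifferentiableAt ℝ B x) :
    DifferentiableAt ℝ (fun z => eta (A z) (B z)) x :=
  ((etaL n).hasFDerivAt_of_bilinear hA.hasFDerivAt hB.hasFDerivAt).differentiableAt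

theorem pderiv_eta {A B : (Fin n → ℝ) → (Fin (n + 2) → ℝ)} {x : Fin n → ℝ}
    (hA : DifferentiableAt ℝ A x) (hB : DifferentiableAt ℝ B x) (i : Fin n) :
    pderiv i (fun z => eta (A z) (B z)) x
      = eta (fderiv ℝ A x (Pi.single i 1)) (B x) + eta (A x) (fderiv ℝ B x (Pi.single i 1)) := by
  have h := (etaL n).fderiv_of_bilinear hA hB
  simp only [etaL_apply] at h
  rw [pderiv, h]
  simp [etaL_apply, add_comm]

variable {U : Set (Fin n → ℝ)} {φ : (Fin n → ℝ) → (Fin (n + 2) → ℝ)}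

theorem contDiffOn_coordField (hU : IsOpen U) (hφ : ContDiffOn ℝ ∞ φ U) (i : Fin n) :
    ContDiffOn ℝ ∞ (coordField φ i) U :=
  (hφ.fderiv_of_isOpen hU (by simp)).clm_apply contDiffOn_const

theorem contDiffOn_coordField₂ (hU : IsOpen U) (hφ : ContDiffOn ℝ ∞ φ U) (i j : Fin n) :
    ContDiffOn ℝ ∞ (coordField₂ φ i j) U :=
  ((contDiffOn_coordField hU hφ j).fderiv_of_isOpen hU (by simp)).clm_apply contDiffOn_const

theorem differentiableAt_of_contDiffOn {E F : Type*} [NormedAddCommGroup E] [NormedSpace ℝ E]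
    [NormedAddCommGroup F] [NormedSpace ℝ F] {s : Set E} {h : E → F} (hs : IsOpen s)
    (hh : ContDiffOn ℝ ∞ h s) {x : E} (hx : x ∈ s) : DifferentiableAt ℝ h x :=
  (hh.contDiffAt (hs.mem_nhds hx)).differentiableAt (by simp)

theorem fderiv_fderiv_symm {E F : Type*} [NormedAddCommGroup E] [NormedSpace ℝ E]
    [NormedAddCommGroup F] [NormedSpace ℝ F] {s : Set E} {h : E → F} (hs : IsOpen s)
    (hh : ContDiffOn ℝ ∞ h s) {x : E} (hx : x ∈ s) (u v : E) :
    fderiv ℝ (fderiv ℝ h) x u v = fderiv ℝ (fderiv ℝ h) x v u :=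
  (hh.contDiffAt (hs.mem_nhds hx)).isSymmSndFDerivAt
    (by rw [minSmoothness_of_isRCLikeNormedField]; exact ENat.LEInfty.out) u v

theorem fderiv_fderiv_apply {E F : Type*} [NormedAddCommGroup E] [NormedSpace ℝ E]
    [NormedAddCommGroup F] [NormedSpace ℝ F] {s : Set E} {h : E → F} (hs : IsOpen s)
    (hh : ContDiffOn ℝ ∞ h s) {x : E} (hx : x ∈ s) (u v : E) :
    fderiv ℝ (fun z => fderiv ℝ h z v) x u = fderiv ℝ (fderiv ℝ h) x u v := by
  have hd : DifferentiableAt ℝ (fderiv ℝ h) x :=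
    differentiableAt_of_contDiffOn hs (hh.fderiv_of_isOpen hs (by simp)) hx
  rw [fderiv_clm_apply hd (by fun_prop)]
  simp

theorem coordField₂_eq (hU : IsOpen U) (hφ : ContDiffOn ℝ ∞ φ U) {x : Fin n → ℝ} (hx : x ∈ U)
    (i j : Fin n) :
    coordField₂ φ i j x = fderiv ℝ (fderiv ℝ φ) x (Pi.single i 1) (Pi.single j 1) :=
  fderiv_fderiv_apply hU hφ hx _ _

theorem coordField₂_symm (hU : IsOpen U) (hφ : ContDiffOn ℝ ∞ φ U) {x : Fin n → ℝ} (hx : x ∈ U)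
    (i j : Fin n) : coordField₂ φ i j x = coordField₂ φ j i x := by
  rw [coordField₂_eq hU hφ hx, coordField₂_eq hU hφ hx, fderiv_fderiv_symm hU hφ hx]

/-- Third derivatives commute: `∂_a ∂_b ∂_d φ = ∂_b ∂_a ∂_d φ`. -/
theorem fderiv_coordField₂_symm (hU : IsOpen U) (hφ : ContDiffOn ℝ ∞ φ U) {x : Fin n → ℝ}
    (hx : x ∈ U) (a b d : Fin n) :
    fderiv ℝ (coordField₂ φ b d) x (Pi.single a 1)
      = fderiv ℝ (coordField₂ φ a d) x (Pi.single b 1) := by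
  have hd := contDiffOn_coordField hU hφ d
  unfold coordField₂
  rw [fderiv_fderiv_apply hU hd hx, fderiv_fderiv_apply hU hd hx, fderiv_fderiv_symm hU hd hx]

theorem differentiableAt_det {m : Type*} [Fintype m] [DecidableEq m]
    {A : (Fin n → ℝ) → Matrix m m ℝ} {x : Fin n → ℝ}
    (hA : ∀ i j, DifferentiableAt ℝ (fun z => A z i j) x) :
    DifferentiableAt ℝ (fun z => (A z).det) x := by
  simp only [Matrix.det_apply']
  refine DifferentiableAt.fun_sum fun σ _ => ?_
  exact (HasFDerivAt.finsetProd fun i _ => (hA (σ i) i).hasFDerivAt).differentiableAt.const_mul _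

/-- Cramer's rule. It is needed because `christoffel` contains the inverse metric and `curvatureOp`
differentiates it. -/
theorem differentiableAt_matrix_inv {m : Type*} [Fintype m] [DecidableEq m]
    {A : (Fin n → ℝ) → Matrix m m ℝ} {x : Fin n → ℝ}
    (hA : ∀ i j, DifferentiableAt ℝ (fun z => A z i j) x) (hx : (A x).det ≠ 0) (i j : m) :
    DifferentiableAt ℝ (fun z => (A z)⁻¹ i j) x := by
  simp only [Matrix.inv_def, Matrix.smul_apply, Ring.inverse_eq_inv', Matrix.adjugate_apply,
    smul_eq_mul]
  refine ((differentiableAt_det hA).inv hx).mul (differentiableAt_det fun k l => ?_)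
  -- The adjugate entry is the determinant of the matrix whose row `j` has been replaced by a
  -- constant basis vector.
  by_cases hk : k = j
  · simp [hk]
  · simpa [Matrix.updateRow_apply, hk] using hA k l

theorem pderiv_inducedMetric (hU : IsOpen U) (hφ : ContDiffOn ℝ ∞ φ U) {x : Fin n → ℝ}
    (hx : x ∈ U) (i j l : Fin n) :
    pderiv i (fun z => inducedMetric φ z j l) x
      = eta (coordField₂ φ i j x) (coordField φ l x)
        + eta (coordField φ j x) (coordField₂ φ i l x) :=
  pderiv_eta (differentiableAt_of_contDiffOn hU (contDiffOn_coordField hU hφ j) hx)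
    (differentiableAt_of_contDiffOn hU (contDiffOn_coordField hU hφ l) hx) i

/-- The product rule turns the three metric derivatives into six terms. By symmetry of second
derivatives four cancel and two agree, absorbing the factor ½. -/
theorem christoffel_inducedMetric (hU : IsOpen U) (hφ : ContDiffOn ℝ ∞ φ U) {x : Fin n → ℝ}
    (hx : x ∈ U) (k i j : Fin n) :
    christoffel (inducedMetric φ) k i j x
      = ∑ l, (inducedMetric φ x)⁻¹ k l * eta (coordField₂ φ i j x) (coordField φ l x) := by
  rw [christoffel, Finset.mul_sum]
  refine Finset.sum_congr rfl fun l _ => ?_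
  rw [pderiv_inducedMetric hU hφ hx, pderiv_inducedMetric hU hφ hx,
    pderiv_inducedMetric hU hφ hx, coordField₂_symm hU hφ hx j i, coordField₂_symm hU hφ hx l i,
    coordField₂_symm hU hφ hx l j, eta_comm (coordField φ j x), eta_comm (coordField φ i x)]
  ring

theorem sum_inducedMetric_mul_christoffel (hU : IsOpen U) (hφ : ContDiffOn ℝ ∞ φ U)
    {x : Fin n → ℝ} (hx : x ∈ U) (hdet : (inducedMetric φ x).det ≠ 0) (c i j : Fin n) :
    ∑ l, inducedMetric φ x c l * christoffel (inducedMetric φ) l i j x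
      = eta (coordField₂ φ i j x) (coordField φ c x) := by
  simp only [christoffel_inducedMetric hU hφ hx, Finset.mul_sum, ← mul_assoc]
  rw [Finset.sum_comm]
  simp only [← Finset.sum_mul, ← Matrix.mul_apply]
  rw [Matrix.mul_nonsing_inv _ hdet.isUnit]
  simp [Matrix.one_apply]

theorem differentiableAt_christoffel (hU : IsOpen U) (hφ : ContDiffOn ℝ ∞ φ U)
    {x : Fin n → ℝ} (hx : x ∈ U) (hdet : (inducedMetric φ x).det ≠ 0) (k i j : Fin n) :
    DifferentiableAt ℝ (christoffel (inducedMetric φ) k i j) x := by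
  have he := fun i => differentiableAt_of_contDiffOn hU (contDiffOn_coordField hU hφ i) hx
  have he2 := fun i j =>
    differentiableAt_of_contDiffOn hU (contDiffOn_coordField₂ hU hφ i j) hx
  have h : (fun z => ∑ l, (inducedMetric φ z)⁻¹ k l *
      eta (coordField₂ φ i j z) (coordField φ l z)) =ᶠ[𝓝 x] christoffel (inducedMetric φ) k i j := by
    filter_upwards [hU.mem_nhds hx] with z hz
    exact (christoffel_inducedMetric hU hφ hz k i j).symm
  refine DifferentiableAt.congr_of_eventuallyEq ?_ h.symm
  refine DifferentiableAt.fun_sum fun l _ => ?_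
  exact (differentiableAt_matrix_inv (fun a b => differentiableAt_eta (he a) (he b)) hdet k l).mul
    (differentiableAt_eta (he2 i j) (he l))

/-- This is the derivative of the lowered identity `sum_inducedMetric_mul_christoffel`, solved for
the term with ∂Γ; the derivative of the inverse metric never has to be computed. -/
theorem sum_inducedMetric_mul_pderiv_christoffel (hU : IsOpen U) (hφ : ContDiffOn ℝ ∞ φ U)
    (hdet : ∀ x ∈ U, (inducedMetric φ x).det ≠ 0) {x : Fin n → ℝ} (hx : x ∈ U)
    (c a b d : Fin n) :
    ∑ l, inducedMetric φ x c l * pderiv a (christoffel (inducedMetric φ) l b d) x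
      = eta (fderiv ℝ (coordField₂ φ b d) x (Pi.single a 1)) (coordField φ c x)
        + eta (coordField₂ φ b d x) (coordField₂ φ a c x)
        - ∑ l, (eta (coordField₂ φ a c x) (coordField φ l x)
            + eta (coordField φ c x) (coordField₂ φ a l x))
          * christoffel (inducedMetric φ) l b d x := by
  have he := fun i => differentiableAt_of_contDiffOn hU (contDiffOn_coordField hU hφ i) hx
  have he2 := fun i j =>
    differentiableAt_of_contDiffOn hU (contDiffOn_coordField₂ hU hφ i j) hx
  have hΓ := fun l => differentiableAt_christoffel hU hφ hx (hdet x hx) l b d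
  have hg : ∀ l, DifferentiableAt ℝ (fun z => inducedMetric φ z c l) x :=
    fun l => differentiableAt_eta (he c) (he l)
  have h : (fun z => ∑ l, inducedMetric φ z c l * christoffel (inducedMetric φ) l b d z)
      =ᶠ[𝓝 x] fun z => eta (coordField₂ φ b d z) (coordField φ c z) := by
    filter_upwards [hU.mem_nhds hx] with z hz
    exact sum_inducedMetric_mul_christoffel hU hφ hz (hdet z hz) c b d
  have h1 : pderiv a (fun z => ∑ l, inducedMetric φ z c l *
      christoffel (inducedMetric φ) l b d z) x
      = pderiv a (fun z => eta (coordField₂ φ b d z) (coordField φ c z)) x := by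
    rw [pderiv, pderiv, h.fderiv_eq]
  rw [pderiv_eta (he2 b d) (he c), pderiv, fderiv_fun_sum fun l _ => (hg l).fun_mul (hΓ l)] at h1
  rw [eq_sub_iff_add_eq, ← Finset.sum_add_distrib]
  refine Eq.trans ?_ h1
  rw [sum_apply]
  refine Finset.sum_congr rfl fun l _ => ?_
  rw [fderiv_fun_mul (hg l) (hΓ l), ← pderiv_inducedMetric hU hφ hx]
  simp only [pderiv, add_apply, smul_apply, smul_eq_mul]
  ring

/-- The Gauss equation. -/
theorem riemannCoeff_inducedMetric (hU : IsOpen U) (hφ : ContDiffOn ℝ ∞ φ U)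
    (hdet : ∀ x ∈ U, (inducedMetric φ x).det ≠ 0) {x : Fin n → ℝ} (hx : x ∈ U)
    (c d a b : Fin n) :
    riemannCoeff (inducedMetric φ) c d a b x
      = (eta (coordField₂ φ b d x) (coordField₂ φ a c x)
          - ∑ l, christoffel (inducedMetric φ) l b d x
            * eta (coordField φ l x) (coordField₂ φ a c x))
        - (eta (coordField₂ φ a d x) (coordField₂ φ b c x)
          - ∑ l, christoffel (inducedMetric φ) l a d x
            * eta (coordField φ l x) (coordField₂ φ b c x)) := by
  have hq : ∀ a b, ∑ l, inducedMetric φ x c l * ∑ m, christoffel (inducedMetric φ) l a m x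
        * christoffel (inducedMetric φ) m b d x
      = ∑ m, eta (coordField φ c x) (coordField₂ φ a m x)
        * christoffel (inducedMetric φ) m b d x := by
    intro a b
    simp only [Finset.mul_sum, ← mul_assoc]
    rw [Finset.sum_comm]
    refine Finset.sum_congr rfl fun m _ => ?_
    rw [← Finset.sum_mul, sum_inducedMetric_mul_christoffel hU hφ hx (hdet x hx), eta_comm]
  simp only [riemannCoeff, curvatureOp, mul_add, mul_sub, Finset.sum_add_distrib,
    Finset.sum_sub_distrib, hq]
  -- The third derivatives of φ are symmetric in `a`, `b` and cancel; the quadratic terms `hq`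
  -- cancel the sums η(∂_cφ, ∂_a∂_lφ) Γ^l_{bd} and their counterparts with `a`, `b` exchanged.
  rw [sum_inducedMetric_mul_pderiv_christoffel hU hφ hdet hx,
    sum_inducedMetric_mul_pderiv_christoffel hU hφ hdet hx, fderiv_coordField₂_symm hU hφ hx a b]
  have hs : ∀ a b, ∑ l, christoffel (inducedMetric φ) l b d x
      * eta (coordField φ l x) (coordField₂ φ a c x)
      = ∑ l, eta (coordField₂ φ a c x) (coordField φ l x)
        * christoffel (inducedMetric φ) l b d x := fun a b =>
    Finset.sum_congr rfl fun l _ => by rw [eta_comm, mul_comm]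
  simp only [hs, add_mul, Finset.sum_add_distrib]
  ring

/-- The Gauss equation in terms of an adapted frame. -/
theorem riemannCoeff_of_isAdaptedFrame (hU : IsOpen U) (hφ : ContDiffOn ℝ ∞ φ U)
    {y F : (Fin n → ℝ) → Fin (n + 2) → ℝ}
    (hfr : ∀ x ∈ U, IsAdaptedFrame (fun i => coordField φ i x) (y x) (F x)) {x : Fin n → ℝ}
    (hx : x ∈ U) {h H : Fin n → Fin n → ℝ}
    (hh : ∀ i j, eta (coordField₂ φ i j x) (y x) = -h i j)
    (hH : ∀ i j, eta (coordField₂ φ i j x) (F x) = -H i j) (c d a b : Fin n) :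
    riemannCoeff (inducedMetric φ) c d a b x
      = (H b d * h a c + h b d * H a c - eta (F x) (F x) * h b d * h a c)
        - (H a d * h b c + h a d * H b c - eta (F x) (F x) * h a d * h b c) := by
  rw [riemannCoeff_inducedMetric hU hφ (fun z hz => (hfr z hz).det_gram_ne_zero) hx,
    (hfr x hx).eta_eq (coordField₂ φ b d x) (coordField₂ φ a c x),
    (hfr x hx).eta_eq (coordField₂ φ a d x) (coordField₂ φ b c x)]
  simp only [christoffel_inducedMetric hU hφ hx, ← inducedMetric_eq_gram, hh, hH]
  ring

end Gauss

/-! ### Homogeneous functions and the submanifold `X_f` -/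

section Homogeneous

variable {n : ℕ} {Ω : Set (Fin (n + 2) → ℝ)} {f : (Fin (n + 2) → ℝ) → ℝ}

namespace IsHomogeneousDefining

theorem differentiableAt (hf : IsHomogeneousDefining Ω f) {y : Fin (n + 2) → ℝ} (hy : y ∈ Ω) :
    DifferentiableAt ℝ f y :=
  differentiableAt_of_contDiffOn hf.isOpen hf.smooth hy

theorem differentiableAt_fderiv (hf : IsHomogeneousDefining Ω f) {y : Fin (n + 2) → ℝ}
    (hy : y ∈ Ω) : DifferentiableAt ℝ (fderiv ℝ f) y :=
  differentiableAt_of_contDiffOn hf.isOpen (hf.smooth.fderiv_of_isOpen hf.isOpen (by simp)) hy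

/-- Euler's identity. -/
theorem fderiv_self (hf : IsHomogeneousDefining Ω f) {y : Fin (n + 2) → ℝ} (hy : y ∈ Ω) :
    fderiv ℝ f y y = f y := by
  have hl : HasDerivAt (fun t : ℝ => t • y) y 1 := by
    simpa using (hasDerivAt_id (1 : ℝ)).smul_const y
  have h1 : HasDerivAt (fun t : ℝ => f (t • y)) (fderiv ℝ f y y) 1 := by
    have h : HasFDerivAt f (fderiv ℝ f y) ((1 : ℝ) • y) := by
      rw [one_smul]
      exact (hf.differentiableAt hy).hasFDerivAt
    exact h.comp_hasDerivAt (1 : ℝ) hl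
  have h2 : HasDerivAt (fun t : ℝ => t * f y) (f y) 1 := by
    simpa using (hasDerivAt_id (1 : ℝ)).mul_const (f y)
  have h3 : (fun t : ℝ => f (t • y)) =ᶠ[𝓝 1] fun t => t * f y := by
    filter_upwards [lt_mem_nhds (zero_lt_one' ℝ)] with t ht
    exact hf.homogeneous y hy t ht
  exact (h1.congr_of_eventuallyEq h3.symm).unique h2

theorem hess_comm (hf : IsHomogeneousDefining Ω f) {y : Fin (n + 2) → ℝ} (hy : y ∈ Ω)
    (u v : Fin (n + 2) → ℝ) : hess f y u v = hess f y v u :=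
  fderiv_fderiv_symm hf.isOpen hf.smooth hy u v

/-- Differentiating Euler's identity df_z(z) = f(z) along `u` gives Hess(u, y) + df(u) = df(u). -/
theorem hess_self_right (hf : IsHomogeneousDefining Ω f) {y : Fin (n + 2) → ℝ} (hy : y ∈ Ω)
    (u : Fin (n + 2) → ℝ) : hess f y u y = 0 := by
  have h : (fun z => fderiv ℝ f z z) =ᶠ[𝓝 y] f := by
    filter_upwards [hf.isOpen.mem_nhds hy] with z hz using hf.fderiv_self hz
  have h1 := congrArg (fun A => A u) (h.fderiv_eq (𝕜 := ℝ))
  have h2 := fderiv_clm_apply (hf.differentiableAt_fderiv hy) 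
    (differentiableAt_fun_id : DifferentiableAt ℝ (fun z => z) y)
  simp only [h2] at h1
  simpa [hess, fderiv_fun_id] using h1

theorem hess_self_left (hf : IsHomogeneousDefining Ω f) {y : Fin (n + 2) → ℝ} (hy : y ∈ Ω)
    (u : Fin (n + 2) → ℝ) : hess f y y u = 0 := by
  rw [hf.hess_comm hy, hf.hess_self_right hy]

end IsHomogeneousDefining

theorem eta_self_of_mem {y : Fin (n + 2) → ℝ} (hy : y ∈ Xf Ω f) : eta y y = 0 := by
  have := hy.2.1
  linarith

end Homogeneous

/-! ### The adapted frame of a local parametrization -/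

section Frame

variable {n : ℕ} {Ω : Set (Fin (n + 2) → ℝ)} {f : (Fin (n + 2) → ℝ) → ℝ}
  {U : Set (Fin n → ℝ)} {φ : (Fin n → ℝ) → (Fin (n + 2) → ℝ)}

theorem fderiv_eq_sum (φ : (Fin n → ℝ) → (Fin (n + 2) → ℝ)) (x p : Fin n → ℝ) :
    fderiv ℝ φ x p = ∑ i, p i • coordField φ i x := by
  conv_lhs => rw [pi_eq_sum_univ' p]
  simp [coordField]

namespace IsLocalParam

/-- That φ maps into `X_f` is hidden in `open_image`, taken with `W = U`. -/
theorem mem (hφ : IsLocalParam (Xf Ω f) U φ) {x : Fin n → ℝ} (hx : x ∈ U) : φ x ∈ Xf Ω f := by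
  obtain ⟨V, -, hV⟩ := hφ.open_image U subset_rfl hφ.isOpen
  have : φ x ∈ φ '' U := ⟨x, hx, rfl⟩
  rw [hV] at this
  exact this.1

theorem differentiableAt (hφ : IsLocalParam (Xf Ω f) U φ) {x : Fin n → ℝ} (hx : x ∈ U) :
    DifferentiableAt ℝ φ x :=
  differentiableAt_of_contDiffOn hφ.isOpen hφ.smooth hx

theorem differentiableAt_coordField (hφ : IsLocalParam (Xf Ω f) U φ) {x : Fin n → ℝ}
    (hx : x ∈ U) (i : Fin n) : DifferentiableAt ℝ (coordField φ i) x :=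
  differentiableAt_of_contDiffOn hφ.isOpen (contDiffOn_coordField hφ.isOpen hφ.smooth i) hx

theorem eta_coordField_self (hφ : IsLocalParam (Xf Ω f) U φ) {x : Fin n → ℝ} (hx : x ∈ U)
    (i : Fin n) : eta (coordField φ i x) (φ x) = 0 := by
  have h : (fun z => eta (φ z) (φ z)) =ᶠ[𝓝 x] fun _ => 0 := by
    filter_upwards [hφ.isOpen.mem_nhds hx] with z hz using eta_self_of_mem (hφ.mem hz)
  have h1 := pderiv_eta (hφ.differentiableAt hx) (hφ.differentiableAt hx) i
  rw [pderiv, h.fderiv_eq, eta_comm (φ x)] at h1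
  simp only [fderiv_fun_const, Pi.zero_apply, zero_apply] at h1
  change 0 = eta (coordField φ i x) (φ x) + eta (coordField φ i x) (φ x) at h1
  linarith

theorem fderiv_coordField (hf : IsHomogeneousDefining Ω f) (hφ : IsLocalParam (Xf Ω f) U φ)
    {x : Fin n → ℝ} (hx : x ∈ U) (i : Fin n) : fderiv ℝ f (φ x) (coordField φ i x) = 0 := by
  have h : (fun z => f (φ z)) =ᶠ[𝓝 x] fun _ => 1 := by
    filter_upwards [hφ.isOpen.mem_nhds hx] with z hz using (hφ.mem hz).2.2
  have h1 := fderiv_fun_comp x (hf.differentiableAt (hφ.mem hx).1) (hφ.differentiableAt hx)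
  rw [h.fderiv_eq] at h1
  have h2 := congrArg (fun A => A (Pi.single i 1)) h1
  simpa [coordField] using h2.symm

theorem linearIndependent_coordField (hφ : IsLocalParam (Xf Ω f) U φ) {x : Fin n → ℝ}
    (hx : x ∈ U) : LinearIndependent ℝ fun i => coordField φ i x := by
  rw [Fintype.linearIndependent_iff]
  intro g hg
  rw [← fderiv_eq_sum] at hg
  have : g = 0 := hφ.immersion x hx (by rw [hg, map_zero])
  exact congrFun this

theorem isAdaptedFrame (hf : IsHomogeneousDefining Ω f) (hφ : IsLocalParam (Xf Ω f) U φ)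
    {x : Fin n → ℝ} (hx : x ∈ U) :
    IsAdaptedFrame (fun i => coordField φ i x) (φ x) (grad f (φ x)) where
  linearIndependent := hφ.linearIndependent_coordField hx
  null := eta_self_of_mem (hφ.mem hx)
  pairing := by rw [eta_grad, hf.fderiv_self (hφ.mem hx).1, (hφ.mem hx).2.2]
  orthogonal_null := hφ.eta_coordField_self hx
  orthogonal_grad i := by rw [eta_comm, eta_grad, hφ.fderiv_coordField hf hx]

/-- Obtained by differentiating η(∂_jφ, φ) = 0: along the normal `y` the second fundamental form is
minus the metric. -/
theorem eta_coordField₂_self (hφ : IsLocalParam (Xf Ω f) U φ) {x : Fin n → ℝ} (hx : x ∈ U)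
    (i j : Fin n) :
    eta (coordField₂ φ i j x) (φ x) = -eta (coordField φ i x) (coordField φ j x) := by
  have h : (fun z => eta (coordField φ j z) (φ z)) =ᶠ[𝓝 x] fun _ => 0 := by
    filter_upwards [hφ.isOpen.mem_nhds hx] with z hz using hφ.eta_coordField_self hz j
  have h1 := pderiv_eta (hφ.differentiableAt_coordField hx j) (hφ.differentiableAt hx) i
  rw [pderiv, h.fderiv_eq, eta_comm (coordField φ j x)] at h1
  simp only [fderiv_fun_const, Pi.zero_apply, zero_apply] at h1
  change 0 = eta (coordField₂ φ i j x) (φ x) + eta (coordField φ i x) (coordField φ j x) at h1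
  linarith

/-- Obtained by differentiating df(∂_jφ) = 0: along the normal `F` the second fundamental form is
minus the Hessian. -/
theorem eta_coordField₂_grad (hf : IsHomogeneousDefining Ω f) (hφ : IsLocalParam (Xf Ω f) U φ)
    {x : Fin n → ℝ} (hx : x ∈ U) (i j : Fin n) :
    eta (coordField₂ φ i j x) (grad f (φ x))
      = -hess f (φ x) (coordField φ i x) (coordField φ j x) := by
  have h : (fun z => fderiv ℝ f (φ z) (coordField φ j z)) =ᶠ[𝓝 x] fun _ => 0 := by
    filter_upwards [hφ.isOpen.mem_nhds hx] with z hz using hφ.fderiv_coordField hf hz j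
  have hd := hf.differentiableAt_fderiv (hφ.mem hx).1
  have h1 := fderiv_clm_apply (hd.fun_comp' x (hφ.differentiableAt hx))
    (hφ.differentiableAt_coordField hx j)
  rw [h.fderiv_eq, fderiv_fun_comp x hd (hφ.differentiableAt hx)] at h1
  have h2 := congrArg (fun A => A (Pi.single i 1)) h1
  simp at h2
  change 0 = fderiv ℝ f (φ x) (coordField₂ φ i j x)
    + hess f (φ x) (coordField φ i x) (coordField φ j x) at h2
  rw [eta_comm, eta_grad]
  linarith

/-- The components of the Riemann tensor. -/
theorem riemannCoeff_eq (hf : IsHomogeneousDefining Ω f) (hφ : IsLocalParam (Xf Ω f) U φ)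
    {x : Fin n → ℝ} (hx : x ∈ U) (c d a b : Fin n) :
    riemannCoeff (inducedMetric φ) c d a b x = -(1 / 2 : ℝ) * kulkarniNomizu eta
      (fun a b => gradSq f (φ x) * eta a b - 2 * hess f (φ x) a b)
      (coordField φ c x) (coordField φ d x) (coordField φ a x) (coordField φ b x) := by
  rw [riemannCoeff_of_isAdaptedFrame hφ.isOpen hφ.smooth
    (fun z hz => hφ.isAdaptedFrame hf hz) hx (hφ.eta_coordField₂_self hx)
    (hφ.eta_coordField₂_grad hf hx)]
  have hs := hf.hess_comm (hφ.mem hx).1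
  simp only [kulkarniNomizu, gradSq]
  rw [hs (coordField φ a x) (coordField φ c x), hs (coordField φ b x) (coordField φ d x),
    hs (coordField φ b x) (coordField φ c x), hs (coordField φ a x) (coordField φ d x),
    eta_comm (coordField φ a x) (coordField φ c x), eta_comm (coordField φ b x) (coordField φ d x),
    eta_comm (coordField φ b x) (coordField φ c x), eta_comm (coordField φ a x) (coordField φ d x)]
  ring

end IsLocalParam

end Frame

/-! ### Contractions -/

section Contraction

variable {n : ℕ}

theorem sum_apply_basis {E : Type*} [AddCommGroup E] [Module ℝ E] {T : E → ℝ}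
    (hT : IsLinearMap ℝ T) (e : Fin n → E) (p : Fin n → ℝ) :
    T (∑ i, p i • e i) = ∑ i, T (e i) * p i := by
  have h := map_sum (hT.mk' T) (fun i => p i • e i) Finset.univ
  simp only [map_smul, IsLinearMap.mk'_apply, smul_eq_mul] at h
  rw [h]
  exact Finset.sum_congr rfl fun i _ => mul_comm _ _

theorem IsAdaptedFrame.trace_gram {e : Fin n → Fin (n + 2) → ℝ} {y F : Fin (n + 2) → ℝ}
    (h : IsAdaptedFrame e y F) : ∑ c, ∑ d, (gram e)⁻¹ c d * gram e c d = n := by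
  have : ∀ c d, (gram e)⁻¹ c d * gram e c d = (gram e)⁻¹ c d * gram e d c := fun c d => by
    rw [gram_apply, gram_apply, eta_comm]
  rw [Finset.sum_congr rfl fun c _ => Finset.sum_congr rfl fun d _ => this c d]
  simp [h.sum_inv_mul_gram]

/-- Tracing slots 2 and 4, the four terms give (tr H) η, n H, -H and -H. -/
theorem sum_mul_kulkarniNomizu {e : Fin n → Fin (n + 2) → ℝ} {y F : Fin (n + 2) → ℝ}
    (h : IsAdaptedFrame e y F) (H : (Fin (n + 2) → ℝ) → (Fin (n + 2) → ℝ) → ℝ)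
    (a b : Fin n) :
    ∑ c, ∑ d, (gram e)⁻¹ c d * kulkarniNomizu eta H (e a) (e c) (e b) (e d)
      = ((n : ℝ) - 2) * H (e a) (e b)
        + (∑ c, ∑ d, (gram e)⁻¹ c d * H (e c) (e d)) * eta (e a) (e b) := by
  have h1 := h.trace_gram
  have h2 : ∑ c, ∑ d, (gram e)⁻¹ c d * (gram e c b * H (e a) (e d)) = H (e a) (e b) := by
    rw [Finset.sum_comm]
    have : ∀ d c, (gram e)⁻¹ c d * (gram e c b * H (e a) (e d))
        = (gram e)⁻¹ d c * gram e c b * H (e a) (e d) := fun d c => by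
      rw [gram_inv_symm e c d]; ring
    simp only [this, ← Finset.sum_mul, h.sum_inv_mul_gram]
    simp
  have h3 : ∑ c, ∑ d, (gram e)⁻¹ c d * (gram e a d * H (e c) (e b)) = H (e a) (e b) := by
    have : ∀ c d, (gram e)⁻¹ c d * (gram e a d * H (e c) (e b))
        = gram e a d * (gram e)⁻¹ d c * H (e c) (e b) := fun c d => by
      rw [gram_inv_symm e c d]; ring
    simp only [this, ← Finset.sum_mul, h.sum_gram_mul_inv]
    simp
  have : ∀ c d, (gram e)⁻¹ c d * kulkarniNomizu eta H (e a) (e c) (e b) (e d)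
      = (gram e)⁻¹ c d * H (e c) (e d) * eta (e a) (e b)
        + (gram e)⁻¹ c d * gram e c d * H (e a) (e b)
        - (gram e)⁻¹ c d * (gram e c b * H (e a) (e d))
        - (gram e)⁻¹ c d * (gram e a d * H (e c) (e b)) := fun c d => by
    rw [kulkarniNomizu, gram_apply, gram_apply, gram_apply]; ring
  simp only [this, Finset.sum_sub_distrib, Finset.sum_add_distrib, h2, h3, ← Finset.sum_mul, h1]
  ring

end Contraction

/-! ### Riemann, Ricci and scalar curvature of `X_f` -/

section Curvature

variable {n : ℕ} {Ω : Set (Fin (n + 2) → ℝ)} {f : (Fin (n + 2) → ℝ) → ℝ}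
  {U : Set (Fin n → ℝ)} {φ : (Fin n → ℝ) → (Fin (n + 2) → ℝ)}

theorem hess_add_left (f : (Fin (n + 2) → ℝ) → ℝ) (y u v w : Fin (n + 2) → ℝ) :
    hess f y (u + v) w = hess f y u w + hess f y v w := by simp [hess]

theorem hess_add_right (f : (Fin (n + 2) → ℝ) → ℝ) (y u v w : Fin (n + 2) → ℝ) :
    hess f y u (v + w) = hess f y u v + hess f y u w := by simp [hess]

theorem hess_smul_left (f : (Fin (n + 2) → ℝ) → ℝ) (y : Fin (n + 2) → ℝ) (c : ℝ)
    (u v : Fin (n + 2) → ℝ) : hess f y (c • u) v = c * hess f y u v := by simp [hess]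

theorem hess_smul_right (f : (Fin (n + 2) → ℝ) → ℝ) (y : Fin (n + 2) → ℝ) (c : ℝ)
    (u v : Fin (n + 2) → ℝ) : hess f y u (c • v) = c * hess f y u v := by simp [hess]

namespace IsLocalParam

theorem riemann_eq (hf : IsHomogeneousDefining Ω f) (hφ : IsLocalParam (Xf Ω f) U φ)
    {x : Fin n → ℝ} (hx : x ∈ U) (p w u v : Fin n → ℝ) :
    riemann (inducedMetric φ) x p w u v =
      -(1 / 2 : ℝ) * kulkarniNomizu eta
        (fun a b => gradSq f (φ x) * eta a b - 2 * hess f (φ x) a b)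
        (fderiv ℝ φ x p) (fderiv ℝ φ x w) (fderiv ℝ φ x u) (fderiv ℝ φ x v) := by
  -- Both sides are linear in each of the four arguments; the expansion uses only bilinearity of the
  -- second form, so it is stated for any such `k`.
  have key : ∀ k : (Fin (n + 2) → ℝ) → (Fin (n + 2) → ℝ) → ℝ,
      (∀ a, IsLinearMap ℝ (k a)) → (∀ b, IsLinearMap ℝ fun a => k a b) →
      -(1 / 2 : ℝ) * kulkarniNomizu eta k
        (fderiv ℝ φ x p) (fderiv ℝ φ x w) (fderiv ℝ φ x u) (fderiv ℝ φ x v)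
      = ∑ c, ∑ d, ∑ a, ∑ b, -(1 / 2 : ℝ) * kulkarniNomizu eta k (coordField φ c x)
        (coordField φ d x) (coordField φ a x) (coordField φ b x) * p c * w d * u a * v b := by
    intro k hk1 hk2
    have l1 : ∀ A B C, IsLinearMap ℝ fun X => -(1 / 2 : ℝ) * kulkarniNomizu eta k X A B C := by
      intro A B C
      constructor
      · intro X Y
        simp only [kulkarniNomizu, eta_add_left, (hk2 _).map_add]; ring
      · intro r X
        simp only [kulkarniNomizu, eta_smul_left, (hk2 _).map_smul, smul_eq_mul]; ring
    have l2 : ∀ A B C, IsLinearMap ℝ fun X => -(1 / 2 : ℝ) * kulkarniNomizu eta k A X B C := by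
      intro A B C
      constructor
      · intro X Y
        simp only [kulkarniNomizu, eta_add_left, (hk2 _).map_add]; ring
      · intro r X
        simp only [kulkarniNomizu, eta_smul_left, (hk2 _).map_smul, smul_eq_mul]; ring
    have l3 : ∀ A B C, IsLinearMap ℝ fun X => -(1 / 2 : ℝ) * kulkarniNomizu eta k A B X C := by
      intro A B C
      constructor
      · intro X Y
        simp only [kulkarniNomizu, eta_add_right, (hk1 _).map_add]; ring
      · intro r X
        simp only [kulkarniNomizu, eta_smul_right, (hk1 _).map_smul, smul_eq_mul]; ring
    have l4 : ∀ A B C, IsLinearMap ℝ fun X => -(1 / 2 : ℝ) * kulkarniNomizu eta k A B C X := by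
      intro A B C
      constructor
      · intro X Y
        simp only [kulkarniNomizu, eta_add_right, (hk1 _).map_add]; ring
      · intro r X
        simp only [kulkarniNomizu, eta_smul_right, (hk1 _).map_smul, smul_eq_mul]; ring
    simp only [fderiv_eq_sum]
    rw [sum_apply_basis (l1 _ _ _)]
    refine Finset.sum_congr rfl fun c _ => ?_
    rw [sum_apply_basis (l2 _ _ _), Finset.sum_mul]
    refine Finset.sum_congr rfl fun d _ => ?_
    rw [sum_apply_basis (l3 _ _ _), Finset.sum_mul, Finset.sum_mul]
    refine Finset.sum_congr rfl fun a _ => ?_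
    rw [sum_apply_basis (l4 _ _ _), Finset.sum_mul, Finset.sum_mul, Finset.sum_mul]
    exact Finset.sum_congr rfl fun b _ => by ring
  rw [key _ (fun a => ⟨fun X Y => by rw [eta_add_right, hess_add_right]; ring, fun r X => by
      rw [eta_smul_right, hess_smul_right, smul_eq_mul]; ring⟩)
    (fun b => ⟨fun X Y => by rw [eta_add_left, hess_add_left]; ring, fun r X => by
      rw [eta_smul_left, hess_smul_left, smul_eq_mul]; ring⟩)]
  simp only [riemann, hφ.riemannCoeff_eq hf hx]

theorem sum_mul_hess (hf : IsHomogeneousDefining Ω f) (hφ : IsLocalParam (Xf Ω f) U φ)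
    {x : Fin n → ℝ} (hx : x ∈ U) :
    ∑ c, ∑ d, (inducedMetric φ x)⁻¹ c d * hess f (φ x) (coordField φ c x) (coordField φ d x)
      = box f (φ x) :=
  ((hφ.isAdaptedFrame hf hx).trace_eq (fderiv ℝ (fderiv ℝ f) (φ x))
    (ContinuousLinearMap.ext fun u => hf.hess_self_left (hφ.mem hx).1 u)
    fun u => hf.hess_self_right (hφ.mem hx).1 u).symm

theorem sum_mul_eta (hf : IsHomogeneousDefining Ω f) (hφ : IsLocalParam (Xf Ω f) U φ)
    {x : Fin n → ℝ} (hx : x ∈ U) :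
    ∑ c, ∑ d, (inducedMetric φ x)⁻¹ c d * eta (coordField φ c x) (coordField φ d x) = n :=
  (hφ.isAdaptedFrame hf hx).trace_gram

/-- With H = 𝐅²η - 2 Hess f one has tr H = n𝐅² - 2□f, and the Ricci tensor is -½[(n - 2)H + (tr
H)η]. -/
theorem ricciCoeff_eq (hf : IsHomogeneousDefining Ω f) (hφ : IsLocalParam (Xf Ω f) U φ)
    {x : Fin n → ℝ} (hx : x ∈ U) (a b : Fin n) :
    ricciCoeff (inducedMetric φ) a b x =
      -((n : ℝ) - 1) * gradSq f (φ x) * eta (coordField φ a x) (coordField φ b x)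
        + ((n : ℝ) - 2) * hess f (φ x) (coordField φ a x) (coordField φ b x)
        + box f (φ x) * eta (coordField φ a x) (coordField φ b x) := by
  have h := sum_mul_kulkarniNomizu (hφ.isAdaptedFrame hf hx)
    (fun a b => gradSq f (φ x) * eta a b - 2 * hess f (φ x) a b)
    a b
  have ht : ∑ c, ∑ d, (inducedMetric φ x)⁻¹ c d *
      (gradSq f (φ x) * eta (coordField φ c x) (coordField φ d x)
        - 2 * hess f (φ x) (coordField φ c x) (coordField φ d x))
      = n * gradSq f (φ x) - 2 * box f (φ x) := by
    rw [← hφ.sum_mul_hess hf hx, ← hφ.sum_mul_eta hf hx]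
    simp only [Finset.sum_mul, Finset.mul_sum, ← Finset.sum_sub_distrib]
    exact Finset.sum_congr rfl fun c _ => Finset.sum_congr rfl fun d _ => by ring
  rw [← inducedMetric_eq_gram, ht] at h
  have hr : ricciCoeff (inducedMetric φ) a b x
      = -(1 / 2 : ℝ) * ∑ c, ∑ d, (inducedMetric φ x)⁻¹ c d * kulkarniNomizu eta
        (fun a b => gradSq f (φ x) * eta a b - 2 * hess f (φ x) a b)
        (coordField φ a x) (coordField φ c x) (coordField φ b x) (coordField φ d x) := by
    simp only [ricciCoeff, hφ.riemannCoeff_eq hf hx, Finset.mul_sum]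
    exact Finset.sum_congr rfl fun c _ => Finset.sum_congr rfl fun d _ => by ring
  rw [hr, h]
  ring

theorem ricci_eq (hf : IsHomogeneousDefining Ω f) (hφ : IsLocalParam (Xf Ω f) U φ)
    {x : Fin n → ℝ} (hx : x ∈ U) (u v : Fin n → ℝ) :
    ricci (inducedMetric φ) x u v =
      -((n : ℝ) - 1) * gradSq f (φ x) * eta (fderiv ℝ φ x u) (fderiv ℝ φ x v)
        + ((n : ℝ) - 2) * hess f (φ x) (fderiv ℝ φ x u) (fderiv ℝ φ x v)
        + box f (φ x) * eta (fderiv ℝ φ x u) (fderiv ℝ φ x v) := by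
  simp only [fderiv_eq_sum φ x u, fderiv_eq_sum φ x v]
  have he : eta (∑ i, u i • coordField φ i x) (∑ i, v i • coordField φ i x)
      = ∑ a, ∑ b, eta (coordField φ a x) (coordField φ b x) * u a * v b := by
    simp only [← etaL_apply, map_sum, map_smul, sum_apply, smul_apply, smul_eq_mul,
      Finset.mul_sum]
    rw [Finset.sum_comm]
    exact Finset.sum_congr rfl fun c _ => Finset.sum_congr rfl fun d _ => by ring
  have hh : hess f (φ x) (∑ i, u i • coordField φ i x) (∑ i, v i • coordField φ i x)
      = ∑ a, ∑ b, hess f (φ x) (coordField φ a x) (coordField φ b x) * u a * v b := by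
    simp only [hess, map_sum, map_smul, sum_apply, smul_apply, smul_eq_mul, Finset.mul_sum]
    rw [Finset.sum_comm]
    exact Finset.sum_congr rfl fun c _ => Finset.sum_congr rfl fun d _ => by ring
  rw [he, hh]
  simp only [ricci, hφ.ricciCoeff_eq hf hx, Finset.mul_sum, ← Finset.sum_add_distrib]
  exact Finset.sum_congr rfl fun c _ => Finset.sum_congr rfl fun d _ => by ring

theorem scalarCurvature_eq (hf : IsHomogeneousDefining Ω f) (hφ : IsLocalParam (Xf Ω f) U φ)
    {x : Fin n → ℝ} (hx : x ∈ U) :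
    scalarCurvature (inducedMetric φ) x =
      -(n : ℝ) * ((n : ℝ) - 1) * gradSq f (φ x) + 2 * ((n : ℝ) - 1) * box f (φ x) := by
  have h : scalarCurvature (inducedMetric φ) x
      = (-((n : ℝ) - 1) * gradSq f (φ x) + box f (φ x)) * n
        + ((n : ℝ) - 2) * box f (φ x) := by
    -- Only the □f with coefficient n - 2 and the outer factor n are unfolded into traces, matching
    -- the Hessian and metric terms of Ricci.
    nth_rewrite 2 [← hφ.sum_mul_hess hf hx]
    nth_rewrite 2 [← hφ.sum_mul_eta hf hx]
    simp only [scalarCurvature, hφ.ricciCoeff_eq hf hx, Finset.mul_sum,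
      ← Finset.sum_add_distrib]
    exact Finset.sum_congr rfl fun c _ => Finset.sum_congr rfl fun d _ => by ring
  rw [h]
  ring

end IsLocalParam

end Curvature

/-! ### Existence of local parametrizations -/

section Existence

/-- A surjective linear map to a plane extends to an isomorphism. -/
theorem exists_continuousLinearEquiv_prod {n : ℕ}
    (A : (Fin (n + 2) → ℝ) →L[ℝ] ℝ × ℝ) (hA : Function.Surjective A) :
    ∃ (L : (Fin (n + 2) → ℝ) →L[ℝ] (Fin n → ℝ))
      (T : (Fin (n + 2) → ℝ) ≃L[ℝ] (ℝ × ℝ) × (Fin n → ℝ)),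
      (T : (Fin (n + 2) → ℝ) →L[ℝ] (ℝ × ℝ) × (Fin n → ℝ)) = A.prod L := by
  obtain ⟨P, hP⟩ := A.ker.exists_isCompl
  have hdim : Module.finrank ℝ A.ker = Module.finrank ℝ (Fin n → ℝ) := by
    have h1 := LinearMap.finrank_range_add_finrank_ker A.toLinearMap
    rw [LinearMap.range_eq_top.mpr hA, finrank_top] at h1
    simp only [Module.finrank_prod, Module.finrank_self, Module.finrank_fin_fun] at h1 ⊢
    omega
  let K := LinearEquiv.ofFinrankEq _ _ hdim
  -- Projection onto ker A along `P`, followed by an isomorphism ker A ≃ ℝⁿ. Its kernel is `P`, a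
  -- complement of ker A, so (A, L) is bijective.
  let L : (Fin (n + 2) → ℝ) →ₗ[ℝ] (Fin n → ℝ) :=
    K.toLinearMap ∘ₗ Submodule.projectionOnto _ P hP
  have hL : L.ker = P := by
    rw [LinearEquiv.ker_comp, Submodule.ker_projectionOnto]
  have hLr : L.range = ⊤ := by
    rw [LinearMap.range_comp, Submodule.range_projectionOnto, Submodule.map_top,
      LinearEquiv.range]
  refine ⟨L.toContinuousLinearMap, A.equivProdOfSurjectiveOfIsCompl L.toContinuousLinearMap
    (LinearMap.range_eq_top.mpr hA) hLr (hL ▸ hP), ?_⟩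
  ext1 v
  rfl

/-- A level set of a smooth submersion to the plane admits local parametrizations. -/
theorem exists_isLocalParam_levelSet {n : ℕ} {Ω : Set (Fin (n + 2) → ℝ)} (hΩ : IsOpen Ω)
    {G : (Fin (n + 2) → ℝ) → ℝ × ℝ} (hG : ContDiffOn ℝ ∞ G Ω) {y : Fin (n + 2) → ℝ}
    (hy : y ∈ Ω) (hs : Function.Surjective (fderiv ℝ G y)) :
    ∃ (U : Set (Fin n → ℝ)) (φ : (Fin n → ℝ) → (Fin (n + 2) → ℝ)),
      IsLocalParam {z | z ∈ Ω ∧ G z = G y} U φ ∧ y ∈ φ '' U := by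
  obtain ⟨L, T, hT⟩ := exists_continuousLinearEquiv_prod (fderiv ℝ G y) hs
  -- Completing `G` by the linear map `L` makes the derivative at `y` invertible; φ will be the
  -- local inverse of Φ on the slice with first component `G y`.
  let Φ : (Fin (n + 2) → ℝ) → (ℝ × ℝ) × (Fin n → ℝ) := fun z => (G z, L z)
  have hΦ : ContDiffOn ℝ ∞ Φ Ω := hG.prodMk L.contDiff.contDiffOn
  have hΦ' : ∀ z ∈ Ω, fderiv ℝ Φ z = (fderiv ℝ G z).prod L := fun z hz =>
    ((differentiableAt_of_contDiffOn hΩ hG hz).hasFDerivAt.prodMk L.hasFDerivAt).fderiv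
  have hΦy : HasFDerivAt Φ (T : (Fin (n + 2) → ℝ) →L[ℝ] (ℝ × ℝ) × (Fin n → ℝ)) y := by
    rw [hT, ← hΦ' y hy]
    exact (differentiableAt_of_contDiffOn hΩ hΦ hy).hasFDerivAt
  -- Shrinking to the open set where DΦ is invertible makes the local inverse smooth at every point
  -- of its domain, not only at Φ(y).
  let S := Ω ∩ fderiv ℝ Φ ⁻¹' Set.range
    ((↑) : ((Fin (n + 2) → ℝ) ≃L[ℝ] (ℝ × ℝ) × (Fin n → ℝ)) →
      (Fin (n + 2) → ℝ) →L[ℝ] (ℝ × ℝ) × (Fin n → ℝ))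
  have hS : IsOpen S :=
    (hΦ.fderiv_of_isOpen (m := ∞) hΩ (by simp)).continuousOn.isOpen_inter_preimage hΩ
      ContinuousLinearEquiv.isOpen
  have hyS : y ∈ S := ⟨hy, T, hΦy.fderiv.symm⟩
  let R₀ := (hΦ.contDiffAt (hΩ.mem_nhds hy)).toOpenPartialHomeomorph Φ hΦy (by simp)
  let R := R₀.restrOpen S hS
  have hR : ∀ z, R z = Φ z := fun _ => rfl
  have hyR : y ∈ R.source :=
    ⟨ContDiffAt.mem_toOpenPartialHomeomorph_source _ hΦy (by simp), hyS⟩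
  have hRS : ∀ z ∈ R.source, z ∈ S := fun z hz => hz.2
  let ι : (Fin n → ℝ) → (ℝ × ℝ) × (Fin n → ℝ) := fun x => (G y, x)
  have hι : ContDiff ℝ ∞ ι := contDiff_const.prodMk contDiff_id
  let U := ι ⁻¹' R.target
  let φ := fun x => R.symm (ι x)
  have hU : IsOpen U := R.open_target.preimage hι.continuous
  have hsrc : ∀ x ∈ U, φ x ∈ R.source := fun x hx => R.map_target hx
  have hval : ∀ x ∈ U, Φ (φ x) = (G y, x) := fun x hx => R.right_inv hx
  have hφ : ContDiffOn ℝ ∞ φ U := by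
    intro x hx
    obtain ⟨hz, T', hT'⟩ := hRS _ (hsrc x hx)
    have hd : HasFDerivAt R (T' : (Fin (n + 2) → ℝ) →L[ℝ] (ℝ × ℝ) × (Fin n → ℝ))
        (R.symm (ι x)) := by
      rw [hT']
      exact (differentiableAt_of_contDiffOn hΩ hΦ hz).hasFDerivAt
    have h := R.contDiffAt_symm hx hd (hΦ.contDiffAt (hΩ.mem_nhds hz))
    exact (h.comp x hι.contDiffAt).contDiffWithinAt
  -- `L` is a linear left inverse of φ. It gives injectivity of φ and of its derivative, and cuts
  -- out φ(W) as the part of the level set in `L ⁻¹' W`.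
  have hLφ : ∀ x ∈ U, L (φ x) = x := fun x hx => congrArg Prod.snd (hval x hx)
  refine ⟨U, φ, ⟨hU, hφ, fun x hx => ?_, fun x hx x' hx' h => ?_, fun W hW hWo => ?_⟩, ?_⟩
  · have h1 : HasFDerivAt (fun z => L (φ z)) (L.comp (fderiv ℝ φ x)) x :=
      L.hasFDerivAt.comp x (differentiableAt_of_contDiffOn hU hφ hx).hasFDerivAt
    have h2 : (fun z => L (φ z)) =ᶠ[𝓝 x] fun z => z := by
      filter_upwards [hU.mem_nhds hx] with z hz using hLφ z hz
    have h3 := (h1.congr_of_eventuallyEq h2.symm).unique (hasFDerivAt_id x)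
    intro u v huv
    have h4 : ∀ u, L (fderiv ℝ φ x u) = u := fun u => congrArg (fun A => A u) h3
    rw [← h4 u, huv, h4]
  · rw [← hLφ x hx, h, hLφ x' hx']
  · refine ⟨R.source ∩ L ⁻¹' W, R.open_source.inter (hWo.preimage L.continuous), ?_⟩
    ext z
    constructor
    · rintro ⟨x, hx, rfl⟩
      exact ⟨⟨(hRS _ (hsrc x (hW hx))).1, congrArg Prod.fst (hval x (hW hx))⟩,
        hsrc x (hW hx), by rw [Set.mem_preimage, hLφ x (hW hx)]; exact hx⟩
    · rintro ⟨⟨-, hz⟩, hzR, hzW⟩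
      refine ⟨L z, hzW, ?_⟩
      have : ι (L z) = R z := by rw [hR]; exact Prod.ext hz.symm rfl
      change R.symm (ι (L z)) = z
      rw [this, R.left_inv hzR]
  · have : ι (L y) = R y := rfl
    refine ⟨L y, ?_, ?_⟩
    · change ι (L y) ∈ R.target
      rw [this]
      exact R.map_source hyR
    · change R.symm (ι (L y)) = y
      rw [this, R.left_inv hyR]

theorem IsHomogeneousDefining.exists_isLocalParam {n : ℕ} {Ω : Set (Fin (n + 2) → ℝ)}
    {f : (Fin (n + 2) → ℝ) → ℝ} (hf : IsHomogeneousDefining Ω f) {y : Fin (n + 2) → ℝ}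
    (hy : y ∈ Xf Ω f) :
    ∃ (U : Set (Fin n → ℝ)) (φ : (Fin n → ℝ) → (Fin (n + 2) → ℝ)),
      IsLocalParam (Xf Ω f) U φ ∧ y ∈ φ '' U := by
  let G : (Fin (n + 2) → ℝ) → ℝ × ℝ := fun z => ((1 / 2 : ℝ) * eta z z, f z)
  have hq : ContDiff ℝ ∞ fun z : Fin (n + 2) → ℝ => (1 / 2 : ℝ) * eta z z := by
    unfold eta
    fun_prop
  have hG : ContDiffOn ℝ ∞ G Ω := hq.contDiffOn.prodMk hf.smooth
  have hq' : HasFDerivAt (fun z : Fin (n + 2) → ℝ => (1 / 2 : ℝ) * eta z z) (etaL n y) y := by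
    have h := ((etaL n).hasFDerivAt_of_bilinear (hasFDerivAt_id y) (hasFDerivAt_id y)).const_mul
      (1 / 2 : ℝ)
    refine h.congr_fderiv ?_
    ext1 v
    change (1 / 2 : ℝ) * (eta y v + eta v y) = eta y v
    rw [eta_comm v y]
    ring
  have hG' : fderiv ℝ G y = (etaL n y).prod (fderiv ℝ f y) :=
    (hq'.prodMk (hf.differentiableAt hy.1).hasFDerivAt).fderiv
  have hsurj : Function.Surjective (fderiv ℝ G y) := by
    have hyy := eta_self_of_mem hy
    have h1 : fderiv ℝ f y y = 1 := by rw [hf.fderiv_self hy.1, hy.2.2]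
    have h2 : eta y (grad f y) = 1 := by rw [eta_comm, eta_grad, h1]
    rintro ⟨a, b⟩
    -- The differential sends `y` to (0, 1) and `grad f y` to (1, df(F)); the multiple of `y`
    -- corrects the second component.
    refine ⟨a • grad f y + (b - a * fderiv ℝ f y (grad f y)) • y, ?_⟩
    rw [hG']
    ext
    · simp [etaL_apply, eta_add_right, eta_smul_right, hyy, h2]
    · simp [h1]
  have hX : {z | z ∈ Ω ∧ G z = G y} = Xf Ω f := by
    ext z
    simp only [Set.mem_ofPred_eq, Xf, G, Prod.ext_iff, hy.2.1, hy.2.2]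
  rw [← hX]
  exact exists_isLocalParam_levelSet hf.isOpen hG hy.1 hsurj

end Existence

end NullCone

theorem mainTheorem1 (n : ℕ) (Ω : Set (Fin (n + 2) → ℝ)) (f : (Fin (n + 2) → ℝ) → ℝ)
    (hf : IsHomogeneousDefining Ω f) :
    -- `X_f` is an `n`-dimensional submanifold: it is covered by local parametrizations
    (∀ y ∈ Xf Ω f, ∃ (U : Set (Fin n → ℝ)) (φ : (Fin n → ℝ) → (Fin (n + 2) → ℝ)),
      IsLocalParam (Xf Ω f) U φ ∧ y ∈ φ '' U) ∧
    -- in each of them, the metric is nondegenerate and its curvature tensors are as claimed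
    ∀ (U : Set (Fin n → ℝ)) (φ : (Fin n → ℝ) → (Fin (n + 2) → ℝ)),
      IsLocalParam (Xf Ω f) U φ → ∀ x ∈ U,
      (inducedMetric φ x).det ≠ 0 ∧
      (∀ p w u v : Fin n → ℝ,
        riemann (inducedMetric φ) x p w u v =
          -(1 / 2 : ℝ) * kulkarniNomizu eta
            (fun a b => gradSq f (φ x) * eta a b - 2 * hess f (φ x) a b)
            (fderiv ℝ φ x p) (fderiv ℝ φ x w) (fderiv ℝ φ x u) (fderiv ℝ φ x v)) ∧
      (∀ u v : Fin n → ℝ,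
        ricci (inducedMetric φ) x u v =
          -((n : ℝ) - 1) * gradSq f (φ x) * eta (fderiv ℝ φ x u) (fderiv ℝ φ x v)
            + ((n : ℝ) - 2) * hess f (φ x) (fderiv ℝ φ x u) (fderiv ℝ φ x v)
            + box f (φ x) * eta (fderiv ℝ φ x u) (fderiv ℝ φ x v)) ∧
      scalarCurvature (inducedMetric φ) x =
        -(n : ℝ) * ((n : ℝ) - 1) * gradSq f (φ x) + 2 * ((n : ℝ) - 1) * box f (φ x) := by
  refine ⟨fun y hy => hf.exists_isLocalParam hy, fun U φ hφ x hx => ?_⟩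
  exact ⟨(hφ.isAdaptedFrame hf hx).det_gram_ne_zero, hφ.riemann_eq hf hx, hφ.ricci_eq hf hx,
    hφ.scalarCurvature_eq hf hx⟩
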